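/- Let $\Gamma$ be a countable discrete group with identity $e$, and let $\lambda,\rho$ be its left and right regular representations on $\ell^2(\Gamma)$, $(\lambda_g\xi)(x)=\xi(g^{-1}x)$ and $(\rho_g\xi)(x)=\xi(xg)$. Let $L(\Gamma)=\{\lambda_g : g\in\Gamma\}''\subseteq B(\ell^2(\Gamma))$ be the group von Neumann algebra and $\mathcal Z(L(\Gamma))$ its center. For a probability measure $\nu$ on $\Gamma$ define, for $T\in B(\ell^2(\Gamma))$, the norm convergent series $$\mathcal P_\nu(T)=\sum_{g\in\Gamma}\nu(g)\,\rho_g T\rho_g^*,\qquad \mathcal P_\nu^o(T)=\sum_{g\in\Gamma}\nu(g)\,\lambda_g^* T\lambda_g ,$$ so that for multiplication operators $M_f$, $f\in\ell^\infty(\Gamma)$, one has $\mathcal P_\nu(M_f)=M_{f*\nu}$ and $\mathcal P^o_\nu(M_f)=M_{\nu*f}$, where $(f*\nu)(x)=\sum_h\nu(h)f(xh)$ and $(\nu*f)(x)=\sum_h\nu(h)f(hx)$. For a map $\Phi$ on $B(\ell^2(\Gamma))$ write $\operatorname{Har}(\Phi)=\{T:\Phi(T)=T\}$. Let $\nu$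 be a probability measure on $\Gamma$ with $e\in\operatorname{supp}\nu$, and let $T\in B(\ell^2(\Gamma))$ satisfy $\mathcal P_\nu\circ\mathcal P_\nu^o(T)=T$. Then $T\in\operatorname{Har}(\mathcal P_\nu)\cap\operatorname{Har}(\mathcal P_\nu^o)$. If, in addition, $\nu$ is symmetric ($\nu(g^{-1})=\nu(g)$ for all $g\in\Gamma$) and generating ($\operatorname{supp}\nu$ generates $\Gamma$ as a group), then $T\in\mathcal Z(L(\Gamma))$. -/

import Mathlib

open scoped ENNReal

noncomputable section

namespace Biharmonic

/-- The Hilbert space `ℓ²(Γ)` of square summable functions `Γ → ℂ`. -/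
abbrev L2 (Γ : Type*) : Type _ := lp (fun _ : Γ => ℂ) 2

/-- The algebra `B(ℓ²(Γ))` of bounded operators on `ℓ²(Γ)`. -/
abbrev BL2 (Γ : Type*) : Type _ := L2 Γ →L[ℂ] L2 Γ

/-- Precomposition with a permutation `σ` of `Γ` preserves square summability. -/
theorem memℓp_comp_perm {Γ : Type*} (σ : Equiv.Perm Γ) (ξ : L2 Γ) :
    Memℓp (fun x => (ξ : Γ → ℂ) (σ x)) 2 := by
  have h := lp.memℓp ξ
  rw [memℓp_gen_iff (by norm_num)] at h ⊢
  exact (Equiv.summable_iff σ (f := fun x => ‖(ξ : Γ → ℂ) x‖ ^ (2 : ℝ≥0∞).toReal)).2 h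

/-- The isometry `ξ ↦ ξ ∘ σ` of `ℓ²(Γ)` given by a permutation `σ` of `Γ`. -/
def permIsometry {Γ : Type*} (σ : Equiv.Perm Γ) : L2 Γ →ₗᵢ[ℂ] L2 Γ where
  toFun ξ := ⟨fun x => (ξ : Γ → ℂ) (σ x), memℓp_comp_perm σ ξ⟩
  map_add' ξ η := by ext x; rfl
  map_smul' c ξ := by ext x; rfl
  norm_map' ξ := by
    rw [lp.norm_eq_tsum_rpow (by norm_num), lp.norm_eq_tsum_rpow (by norm_num)]
    congr 1
    exact Equiv.tsum_eq σ (fun x => ‖(ξ : Γ → ℂ) x‖ ^ (2 : ℝ≥0∞).toReal)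

variable {Γ : Type*} [Group Γ]

/-- The left regular representation, `(λ_g ξ)(x) = ξ(g⁻¹ x)`, i.e. `λ_g δ_x = δ_{g x}`. -/
def leftReg (g : Γ) : BL2 Γ :=
  (permIsometry (Equiv.mulLeft g⁻¹)).toContinuousLinearMap

/-- The right regular representation, `(ρ_g ξ)(x) = ξ(x g)`, i.e. `ρ_g δ_x = δ_{x g⁻¹}`. -/
def rightReg (g : Γ) : BL2 Γ :=
  (permIsometry (Equiv.mulRight g)).toContinuousLinearMap

/-- The Markov operator `𝒫_ν(T) = ∑_g ν(g) ρ_g T ρ_g^*` on `B(ℓ²(Γ))` (a norm convergent series).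
On multiplication operators, `𝒫_ν(M_f) = M_{f ∗ ν}` with `(f ∗ ν)(x) = ∑_g ν(g) f(x g)`. -/
def markov (ν : PMF Γ) (T : BL2 Γ) : BL2 Γ :=
  ∑' g : Γ, (((ν g).toReal : ℝ) : ℂ) • (rightReg g * T * star (rightReg g))

/-- The Markov operator `𝒫_ν^o(T) = ∑_g ν(g) λ_g^* T λ_g` on `B(ℓ²(Γ))` (a norm convergent series).
On multiplication operators, `𝒫_ν^o(M_f) = M_{ν ∗ f}` with `(ν ∗ f)(x) = ∑_g ν(g) f(g x)`. -/
def markovOp (ν : PMF Γ) (T : BL2 Γ) : BL2 Γ :=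
  ∑' g : Γ, (((ν g).toReal : ℝ) : ℂ) • (star (leftReg g) * T * leftReg g)

/-- `Har(Φ)`: the operators fixed by a map `Φ` on `B(ℓ²(Γ))`. -/
def Har (Φ : BL2 Γ → BL2 Γ) : Set (BL2 Γ) := {T | Φ T = T}

/-- `ν` is symmetric: `ν(g⁻¹) = ν(g)` for all `g`. -/
def IsSymmetric (ν : PMF Γ) : Prop := ∀ g : Γ, ν g⁻¹ = ν g

/-- `ν` is generating: its support generates the group `Γ`. -/
def IsGenerating (ν : PMF Γ) : Prop := Subgroup.closure ν.support = ⊤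

/-- The von Neumann algebra generated by a set `S` of operators: the double commutant of
`S ∪ S^*`. -/
def vonNeumannGenerated {H : Type*} [NormedAddCommGroup H] [InnerProductSpace ℂ H]
    [CompleteSpace H] (S : Set (H →L[ℂ] H)) : VonNeumannAlgebra H where
  toStarSubalgebra :=
    StarSubalgebra.centralizer ℂ (StarSubalgebra.centralizer ℂ S : Set (H →L[ℂ] H))
  centralizer_centralizer' := by
    change Set.centralizer (Set.centralizer ((StarSubalgebra.centralizer ℂ
      (StarSubalgebra.centralizer ℂ S : Set (H →L[ℂ] H)) : StarSubalgebra ℂ (H →L[ℂ] H)) :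
        Set (H →L[ℂ] H))) = ((StarSubalgebra.centralizer ℂ
      (StarSubalgebra.centralizer ℂ S : Set (H →L[ℂ] H)) : StarSubalgebra ℂ (H →L[ℂ] H)) :
        Set (H →L[ℂ] H))
    rw [StarSubalgebra.coe_centralizer_centralizer, Set.centralizer_centralizer_centralizer]

variable (Γ) in
/-- The group von Neumann algebra `L(Γ)`, generated by the left regular representation. -/
def groupVN : VonNeumannAlgebra (L2 Γ) :=
  vonNeumannGenerated (Set.range (leftReg : Γ → BL2 Γ))

/-- The center `𝒵(M)` of a von Neumann algebra `M` acting on `H`. -/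
def vonNeumannCenter {H : Type*} [NormedAddCommGroup H] [InnerProductSpace ℂ H]
    [CompleteSpace H] (M : VonNeumannAlgebra H) : Set (H →L[ℂ] H) :=
  {T | T ∈ M ∧ ∀ A ∈ M, T * A = A * T}

end Biharmonic

end

noncomputable section
namespace Biharmonic

/-! ### Fixed points of products of commuting contractions. -/

section CommutingContractions

variable {E : Type*} [NormedAddCommGroup E] [NormedSpace ℂ E]

/-! Write P and U for the two averages, by right and left translations. They are commuting
contractions, and since ν(e) > 0, P is a convex combination of the identity and a contraction. If
PUT = T, then z = PT - T is fixed by UP, so ‖Pⁿz‖ = ‖z‖ for all n. A functional norming P^N z then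
has real part at least ‖z‖ on every Pᵏz with k ≤ N; these vectors telescope to P^N T - T, so N‖z‖ ≤
2‖T‖ for all N and z = 0 (`fixed_of_comp_fixed`).

For the center, let V = P(T*T) - T*T = ∑ ν(g) D_g* D_g with D_g = ρ_g T ρ_g* - T. Each D_g is again
fixed by U, so V ≤ UV by the Schwarz inequality (`defect_le_conjAverage`). The vector state φ at δ_e
satisfies φ∘P = φ∘U, hence ∑ φ(UᵏV) = ∑ φ(PᵏV) telescopes and stays bounded. Its terms are
nonnegative and increasing, so all vanish (`re_pow_apply_coboundary_nonpos`). Unfolding Uᵏ moves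
this vanishing to every δ_w, so every D_g with g in the support is zero and T commutes with ρ. Then
P fixes T*T, so φ(U(T*T)) = φ(T*T); this forces T to commute with λ as well, because δ_e is
separating for operators commuting with ρ. -/

theorem norm_pow_apply_le {P : E →L[ℂ] E} (hP : ∀ w, ‖P w‖ ≤ ‖w‖) (n : ℕ) (w : E) :
    ‖(P ^ n) w‖ ≤ ‖w‖ := by
  induction n with
  | zero => simp
  | succ n ih => rw [pow_succ']; exact (hP _).trans ih

/-- A contraction that is a nontrivial convex combination of the identity and a contraction has no
orbit of differences `P ^ n (P T - T)` of constant nonzero norm. -/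
theorem apply_eq_self_of_norm_pow_sub {P : E →L[ℂ] E} {a : ℝ} (ha : 0 < a)
    (hP : ∀ w, ‖P w‖ ≤ ‖w‖) (hPa : ∀ w, ‖P w - (a : ℂ) • w‖ ≤ (1 - a) * ‖w‖) {T : E}
    (hiso : ∀ n : ℕ, ‖(P ^ n) (P T - T)‖ = ‖P T - T‖) : P T = T := by
  set z := P T - T with hz
  have key : ∀ N : ℕ, N * ‖z‖ ≤ 2 * ‖T‖ := by
    intro N
    obtain ⟨f, hf1, hf⟩ := exists_dual_vector'' ℂ ((P ^ N) z)
    have hfle : ∀ w, (f w).re ≤ ‖w‖ := fun w =>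
      (Complex.re_le_norm _).trans ((f.le_opNorm w).trans
        (mul_le_of_le_one_left (norm_nonneg _) hf1))
    -- Descending induction from k = N: as P - a contributes at most (1 - a)‖z‖, a value of at least
    -- ‖z‖ at `k + 1` forces one at `k`.
    have hback : ∀ j k : ℕ, k + j = N → ‖z‖ ≤ (f ((P ^ k) z)).re := by
      intro j
      induction j with
      | zero =>
        rintro k rfl
        simp only [Nat.add_zero] at hf
        rw [hf]
        exact (hiso k).ge
      | succ j ih =>
        intro k hk
        have h1 := ih (k + 1) (by omega)
        set w := (P ^ k) z with hw
        have hwz : ‖w‖ = ‖z‖ := hiso k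
        have h2 : (f ((P ^ (k + 1)) z)).re = (f (P w - (a : ℂ) • w)).re + a * (f w).re := by
          have : (P ^ (k + 1)) z = P w := by rw [pow_succ']; rfl
          rw [this, map_sub, map_smul]
          simp
        have h3 := (hfle _).trans (hPa w)
        rw [hwz] at h3
        have h4 : a * ‖z‖ ≤ a * (f w).re := by linarith
        exact le_of_mul_le_mul_left h4 ha
    have hsum : ∀ n, n ≤ N → n * ‖z‖ ≤ (f ((P ^ n) T - T)).re := by
      intro n
      induction n with
      | zero => simp
      | succ n ih =>
        intro hn
        have h1 := ih (by omega)
        have h2 := hback (N - n) n (by omega)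
        have h3 : (P ^ (n + 1)) T - T = ((P ^ n) T - T) + (P ^ n) z := by
          rw [hz, map_sub, pow_succ]
          change (P ^ n) (P T) - T = _
          abel
        rw [h3, map_add, Complex.add_re]
        rw [Nat.cast_succ, add_mul, one_mul]
        exact add_le_add h1 h2
    refine (hsum N le_rfl).trans ((hfle _).trans ?_)
    have := norm_sub_le ((P ^ N) T) T
    have := norm_pow_apply_le hP N T
    linarith
  have hz0 : ‖z‖ = 0 := by
    by_contra h
    have hpos : 0 < ‖z‖ := lt_of_le_of_ne (norm_nonneg _) (Ne.symm h)
    obtain ⟨N, hN⟩ := exists_nat_gt (2 * ‖T‖ / ‖z‖)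
    rw [div_lt_iff₀ hpos] at hN
    exact absurd (key N) (not_le.2 hN)
  exact sub_eq_zero.1 (norm_eq_zero.1 hz0)

/-- If `P` and `U` are commuting contractions and `P` is a nontrivial convex combination of the
identity and a contraction, then every fixed point of `P U` is fixed by `P` and by `U`. -/
theorem fixed_of_comp_fixed {P U : E →L[ℂ] E} (hPU : Commute P U) {a : ℝ} (ha : 0 < a)
    (hP : ∀ w, ‖P w‖ ≤ ‖w‖) (hU : ∀ w, ‖U w‖ ≤ ‖w‖)
    (hPa : ∀ w, ‖P w - (a : ℂ) • w‖ ≤ (1 - a) * ‖w‖) {T : E} (hT : P (U T) = T) :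
    P T = T ∧ U T = T := by
  have hcomm : ∀ w, P (U w) = U (P w) := fun w => congrArg (fun f : E →L[ℂ] E => f w) hPU.eq
  have hPT : P T = T := by
    refine apply_eq_self_of_norm_pow_sub ha hP hPa fun n => ?_
    refine le_antisymm (norm_pow_apply_le hP n _) ?_
    have hfix : (U * P) (P T - T) = P T - T := by
      change U (P _) = _
      rw [← hcomm, map_sub U, ← hcomm T, hT, map_sub, hT]
    have hn : ((U * P) ^ n) (P T - T) = P T - T := by
      induction n with
      | zero => rfl
      | succ n ih => rw [pow_succ']; change (U * P) (((U * P) ^ n) _) = _; rw [ih, hfix]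
    rw [hPU.symm.mul_pow] at hn
    calc ‖P T - T‖ = ‖(U ^ n) ((P ^ n) (P T - T))‖ := congrArg norm hn.symm
      _ ≤ _ := norm_pow_apply_le hU n _
  refine ⟨hPT, ?_⟩
  have := hcomm T
  rw [hPT, hT] at this
  exact this.symm

end CommutingContractions

/-! ### Averages of unitary conjugations on a C*-algebra. -/

section ConjAverage

variable {ι A : Type*} [CStarAlgebra A]

/-- Conjugation `X ↦ u X u^*` by a unitary. -/
def conjCLM (u : unitary A) : A →L[ℂ] A :=
  ContinuousLinearMap.mulLeftRight ℂ A (u : A) (star (u : A))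

theorem conjCLM_apply (u : unitary A) (X : A) : conjCLM u X = u * X * star (u : A) := rfl

theorem norm_conjCLM_apply (u : unitary A) (X : A) : ‖conjCLM u X‖ = ‖X‖ := by
  rw [conjCLM_apply, ← Unitary.coe_star, CStarRing.norm_mul_coe_unitary,
    CStarRing.norm_coe_unitary_mul]

theorem norm_conjCLM_le (u : unitary A) : ‖conjCLM u‖ ≤ 1 :=
  ContinuousLinearMap.opNorm_le_bound _ zero_le_one fun X => by rw [norm_conjCLM_apply, one_mul]

theorem conjCLM_mul_star (u : unitary A) (X : A) :
    star (conjCLM u X) * conjCLM u X = conjCLM u (star X * X) := by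
  simp only [conjCLM_apply, star_mul, star_star, mul_assoc]
  rw [← mul_assoc (star (u : A)) (u : A), Unitary.coe_star_mul_self, one_mul]

theorem commute_conjCLM {u v : unitary A} (h : Commute u v) : Commute (conjCLM u) (conjCLM v) := by
  ext X
  have h1 : (u : A) * v = v * u := congrArg Subtype.val h.eq
  have h2 : star (v : A) * star (u : A) = star (u : A) * star (v : A) := by
    rw [← star_mul, ← star_mul, h1]
  change conjCLM u (conjCLM v X) = conjCLM v (conjCLM u X)
  simp only [conjCLM_apply]
  calc (u : A) * (v * X * star (v : A)) * star (u : A)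
      = ((u : A) * v) * X * (star (v : A) * star (u : A)) := by simp only [mul_assoc]
    _ = _ := by rw [h1, h2]; simp only [mul_assoc]

theorem PMF.hasSum_toReal (ν : PMF ι) : HasSum (fun g => (ν g).toReal) 1 := by
  have h := ENNReal.hasSum_toReal (f := ν) (by rw [ν.tsum_coe]; exact ENNReal.one_ne_top)
  rwa [← ENNReal.tsum_toReal_eq (fun g => ν.apply_ne_top g), ν.tsum_coe, ENNReal.toReal_one] at h

variable (ν : PMF ι) (u : ι → unitary A)

/-- The average `X ↦ ∑ ν(g) u_g X u_g^*` of the conjugations by a family of unitaries. -/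
def conjAverage : A →L[ℂ] A := ∑' g, (((ν g).toReal : ℝ) : ℂ) • conjCLM (u g)

theorem norm_smul_conjCLM_le (g : ι) :
    ‖(((ν g).toReal : ℝ) : ℂ) • conjCLM (u g)‖ ≤ (ν g).toReal := by
  rw [norm_smul, Complex.norm_real, Real.norm_of_nonneg ENNReal.toReal_nonneg]
  exact mul_le_of_le_one_right ENNReal.toReal_nonneg (norm_conjCLM_le _)

theorem hasSum_conjAverage :
    HasSum (fun g => (((ν g).toReal : ℝ) : ℂ) • conjCLM (u g)) (conjAverage ν u) :=
  (Summable.of_norm_bounded (PMF.hasSum_toReal ν).summable (norm_smul_conjCLM_le ν u)).hasSum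

theorem hasSum_conjAverage_apply (X : A) :
    HasSum (fun g => (((ν g).toReal : ℝ) : ℂ) • conjCLM (u g) X) (conjAverage ν u X) :=
  (hasSum_conjAverage ν u).mapL (ContinuousLinearMap.apply ℂ A X)

theorem conjAverage_apply (X : A) : conjAverage ν u X =
    ∑' g, (((ν g).toReal : ℝ) : ℂ) • ((u g : A) * X * star (u g : A)) :=
  (hasSum_conjAverage_apply ν u X).tsum_eq.symm

theorem norm_conjAverage_apply_le (X : A) : ‖conjAverage ν u X‖ ≤ ‖X‖ := by
  have h := tsum_of_norm_bounded (PMF.hasSum_toReal ν) (norm_smul_conjCLM_le ν u)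
  exact ((conjAverage ν u).le_opNorm X).trans (mul_le_of_le_one_left (norm_nonneg _) h)

/-- Removing the identity term leaves conjugations of total mass 1 - ν(i). This supplies the convex
combination needed by `fixed_of_comp_fixed`. -/
theorem norm_conjAverage_sub_le {i : ι} (hi : u i = 1) (X : A) :
    ‖conjAverage ν u X - (((ν i).toReal : ℝ) : ℂ) • X‖ ≤ (1 - (ν i).toReal) * ‖X‖ := by
  classical
  have h1 := (hasSum_conjAverage_apply ν u X).sub
    (hasSum_ite_eq i ((((ν i).toReal : ℝ) : ℂ) • X))
  have h2 := ((PMF.hasSum_toReal ν).sub (hasSum_ite_eq i (ν i).toReal)).mul_right ‖X‖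
  rw [← h1.tsum_eq]
  refine tsum_of_norm_bounded h2 fun g => ?_
  by_cases hg : g = i
  · subst hg
    simp [conjCLM_apply, hi]
  · simp [hg, norm_smul, norm_conjCLM_apply]

variable {ν u} in
theorem commute_conjAverage_of_forall {F : A →L[ℂ] A} (h : ∀ g, Commute F (conjCLM (u g))) :
    Commute F (conjAverage ν u) :=
  ContinuousLinearMap.ext fun X => by
    have h1 := F.hasSum (hasSum_conjAverage_apply ν u X)
    have h2 := hasSum_conjAverage_apply ν u (F X)
    refine h1.unique (h2.congr_fun fun g => ?_)
    rw [map_smul]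
    exact congrArg (fun f : A →L[ℂ] A => _ • f X) (h g).eq

/-- The equality form of the Schwarz inequality: expand each square and average. As X is fixed, each
of the two cross terms averages to X*X. -/
theorem hasSum_conjAverage_schwarz {X : A} (hX : conjAverage ν u X = X) :
    HasSum (fun g => (((ν g).toReal : ℝ) : ℂ) •
      (star (conjCLM (u g) X - X) * (conjCLM (u g) X - X)))
      (conjAverage ν u (star X * X) - star X * X) := by
  have h1 := hasSum_conjAverage_apply ν u (star X * X)
  have h2 := hasSum_conjAverage_apply ν u X
  have h3 := h2.star
  rw [hX] at h2 h3
  have h4 := (h2.mul_left (star X))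
  have h5 := (h3.mul_right X)
  have h6 : HasSum (fun g => (((ν g).toReal : ℝ) : ℂ) • (star X * X)) (star X * X) := by
    have := (Complex.ofRealCLM.hasSum (PMF.hasSum_toReal ν)).smul_const (star X * X)
    simpa using this
  have h7 := ((h1.sub h4).sub h5).add h6
  have h8 : conjAverage ν u (star X * X) - star X * X - star X * X + star X * X =
      conjAverage ν u (star X * X) - star X * X := by abel
  rw [h8] at h7
  refine h7.congr_fun fun g => ?_
  simp only [star_sub, sub_mul, mul_sub, conjCLM_mul_star, smul_sub, star_smul, mul_smul_comm,
      smul_mul_assoc, RCLike.star_def, Complex.conj_ofReal]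
  abel

variable [PartialOrder A] [StarOrderedRing A]

theorem ofReal_smul_nonneg {c : ℝ} (hc : 0 ≤ c) {X : A} (hX : 0 ≤ X) : 0 ≤ (c : ℂ) • X := by
  have : (c : ℂ) • X = c • X := by simp
  rw [this]
  exact smul_nonneg hc hX

theorem conjAverage_nonneg {X : A} (hX : 0 ≤ X) : 0 ≤ conjAverage ν u X :=
  (hasSum_conjAverage_apply ν u X).nonneg fun _ =>
    ofReal_smul_nonneg ENNReal.toReal_nonneg (star_right_conjugate_nonneg hX _)

theorem star_mul_self_le_conjAverage {X : A} (hX : conjAverage ν u X = X) :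
    star X * X ≤ conjAverage ν u (star X * X) :=
  sub_nonneg.1 <| (hasSum_conjAverage_schwarz ν u hX).nonneg fun _ =>
    ofReal_smul_nonneg ENNReal.toReal_nonneg (star_mul_self_nonneg _)

/-- If `X` is fixed by two commuting averages, then the defect `P(X^*X) - X^*X` of the first is
subharmonic for the second. -/
theorem defect_le_conjAverage {κ : Type*} (μ : PMF κ) (v : κ → unitary A)
    (huv : ∀ g h, Commute (u g) (v h)) {X : A} (hXu : conjAverage ν u X = X)
    (hXv : conjAverage μ v X = X) :
    conjAverage ν u (star X * X) - star X * X ≤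
      conjAverage μ v (conjAverage ν u (star X * X) - star X * X) := by
  have h := hasSum_conjAverage_schwarz ν u hXu
  refine hasSum_le (fun g => ?_) h ((conjAverage μ v).hasSum h)
  have hc : Commute (conjCLM (u g)) (conjAverage μ v) :=
    commute_conjAverage_of_forall fun k => commute_conjCLM (huv g k)
  -- The second average commutes with conjugation by `u g`, so it fixes each difference, and Schwarz
  -- applies termwise.
  have hD : conjAverage μ v (conjCLM (u g) X - X) = conjCLM (u g) X - X := by
    rw [map_sub, hXv]
    congr 1
    exact (congrArg (fun f : A →L[ℂ] A => f X) hc.eq).symm.trans (congrArg (conjCLM (u g)) hXv)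
  have := ofReal_smul_nonneg (c := (ν g).toReal) ENNReal.toReal_nonneg
    (sub_nonneg.2 (star_mul_self_le_conjAverage μ v hD))
  rw [smul_sub, sub_nonneg] at this
  simpa using this

/-- Let `P`, `U` be commuting maps that agree under a functional `φ`, with `P` contractive and
`φ ∘ U ^ n` positive. A `U`-subharmonic coboundary `P S - S` is killed by all `φ ∘ U ^ n`. -/
theorem re_pow_apply_coboundary_nonpos {P U : A →L[ℂ] A} (hPU : Commute P U)
    {φ : A →L[ℂ] ℂ}
    (hφ : ∀ X, φ (P X) = φ (U X)) (hP : ∀ X, ‖P X‖ ≤ ‖X‖)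
    (hpos : ∀ (n : ℕ) (X : A), 0 ≤ X → 0 ≤ (φ ((U ^ n) X)).re) {S : A}
    (hS0 : S ≤ P S) (hS : P S - S ≤ U (P S - S)) (n : ℕ) : (φ ((U ^ n) (P S - S))).re ≤ 0 := by
  set V := P S - S with hV
  -- Commutation lets the factors U be exchanged for P one at a time under φ.
  have hφn : ∀ (n : ℕ) (X : A), φ ((U ^ n) X) = φ ((P ^ n) X) := by
    intro n
    induction n with
    | zero => intro X; rfl
    | succ n ih =>
      intro X
      have h1 : (U ^ (n + 1)) X = (U ^ n) (U X) := by rw [pow_succ]; rfl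
      have h2 : (P ^ n) (U X) = U ((P ^ n) X) :=
        congrArg (fun f : A →L[ℂ] A => f X) (hPU.pow_left n).eq
      have h3 : (P ^ (n + 1)) X = P ((P ^ n) X) := by rw [pow_succ']; rfl
      rw [h1, ih, h2, h3, hφ]
  have hmono : Monotone fun n => (φ ((U ^ n) V)).re := by
    refine monotone_nat_of_le_succ fun n => ?_
    have h := hpos n _ (sub_nonneg.2 hS)
    have h1 : (U ^ (n + 1)) V = (U ^ n) (U V) := by rw [pow_succ]; rfl
    rw [map_sub, map_sub, Complex.sub_re] at h
    rw [h1]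
    linarith
  have hsum : ∀ N : ℕ, ∑ k ∈ Finset.range N, (φ ((U ^ k) V)).re = (φ ((P ^ N) S)).re - (φ S).re := by
    intro N
    induction N with
    | zero => simp
    | succ N ih =>
      have h3 : (P ^ (N + 1)) S = (P ^ N) (P S) := by rw [pow_succ]; rfl
      rw [Finset.sum_range_succ, ih, hφn, hV, map_sub, map_sub, h3, Complex.sub_re]
      ring
  have hbound : ∀ N : ℕ, ∑ k ∈ Finset.range N, (φ ((U ^ k) V)).re ≤ 2 * (‖φ‖ * ‖S‖) := by
    intro N
    have hle : ∀ X, |(φ X).re| ≤ ‖φ‖ * ‖X‖ := fun X =>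
      (Complex.abs_re_le_norm _).trans (φ.le_opNorm X)
    have h1 := (abs_le.1 (hle ((P ^ N) S))).2
    have h2 := (abs_le.1 (hle S)).1
    have h3 := mul_le_mul_of_nonneg_left (norm_pow_apply_le hP N S) (norm_nonneg φ)
    rw [hsum]
    linarith
  by_contra! hn
  obtain ⟨N, hN⟩ := exists_nat_gt (2 * (‖φ‖ * ‖S‖) / (φ ((U ^ n) V)).re)
  rw [div_lt_iff₀ hn] at hN
  -- By monotonicity, a positive value at `n` is a lower bound for the next `N` terms, which
  -- contradicts the uniform bound.
  have h1 : N * (φ ((U ^ n) V)).re ≤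
      ∑ k ∈ Finset.range (n + N), (φ ((U ^ k) V)).re := by
    rw [Finset.sum_range_add]
    refine le_add_of_nonneg_of_le
      (Finset.sum_nonneg fun k _ => hpos k V (sub_nonneg.2 hS0)) ?_
    rw [← nsmul_eq_mul]
    simpa using Finset.card_nsmul_le_sum (Finset.range N)
      (fun k => (φ ((U ^ (n + k)) V)).re) _ fun k _ => hmono (Nat.le_add_right n k)
  linarith [hbound (n + N)]

end ConjAverage
end Biharmonic
end

noncomputable section
namespace Biharmonic

/-! ### Vector states and vanishing of the defect. -/

section VectorState

variable {H : Type*} [NormedAddCommGroup H] [InnerProductSpace ℂ H] [CompleteSpace H]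

/-- The vector functional `X ↦ ⟪ξ, X ξ⟫`. -/
def vectorState (ξ : H) : (H →L[ℂ] H) →L[ℂ] ℂ :=
  (innerSL ℂ ξ).comp (ContinuousLinearMap.apply ℂ H ξ)

omit [CompleteSpace H] in
theorem vectorState_apply (ξ : H) (X : H →L[ℂ] H) : vectorState ξ X = inner ℂ ξ (X ξ) := rfl

omit [CompleteSpace H] in
theorem re_vectorState_nonneg (ξ : H) {X : H →L[ℂ] H} (hX : 0 ≤ X) :
    0 ≤ (vectorState ξ X).re :=
  ((ContinuousLinearMap.nonneg_iff_isPositive X).1 hX).re_inner_nonneg_right ξ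

theorem re_vectorState_star_mul_self (ξ : H) (D : H →L[ℂ] H) :
    (vectorState ξ (star D * D)).re = ‖D ξ‖ ^ 2 := by
  change (inner ℂ ξ (star D (D ξ))).re = _
  rw [ContinuousLinearMap.star_eq_adjoint,
    ContinuousLinearMap.adjoint_inner_right]
  exact inner_self_eq_norm_sq (𝕜 := ℂ) (D ξ)

theorem vectorState_conjCLM (ξ : H) (u : unitary (H →L[ℂ] H)) (X : H →L[ℂ] H) :
    vectorState ξ (conjCLM u X) = vectorState (star (u : H →L[ℂ] H) ξ) X := by
  rw [vectorState_apply, vectorState_apply, conjCLM_apply, ContinuousLinearMap.star_eq_adjoint,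
    ContinuousLinearMap.adjoint_inner_left]
  rfl

theorem hasSum_vectorState_conjAverage {ι : Type*} (ν : PMF ι) (u : ι → unitary (H →L[ℂ] H))
    (ξ : H) (X : H →L[ℂ] H) :
    HasSum (fun g => (((ν g).toReal : ℝ) : ℂ) * vectorState (star (u g : H →L[ℂ] H) ξ) X)
      (vectorState ξ (conjAverage ν u X)) := by
  refine ((vectorState ξ).hasSum (hasSum_conjAverage_apply ν u X)).congr_fun fun g => ?_
  rw [map_smul, smul_eq_mul, vectorState_conjCLM]

theorem hasSum_re_vectorState_conjAverage {ι : Type*} (ν : PMF ι) (u : ι → unitary (H →L[ℂ] H))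
    (ξ : H) (X : H →L[ℂ] H) :
    HasSum (fun g => (ν g).toReal * (vectorState (star (u g : H →L[ℂ] H) ξ) X).re)
      (vectorState ξ (conjAverage ν u X)).re := by
  refine (Complex.reCLM.hasSum (hasSum_vectorState_conjAverage ν u ξ X)).congr_fun fun g => ?_
  simp

/-- If `X` is fixed by an average and the defect of `X^*X` vanishes at `ξ`, then `X` and its
conjugates by the unitaries in the support agree at `ξ`. -/
theorem conjCLM_apply_eq_of_defect {ι : Type*} {ν : PMF ι} {u : ι → unitary (H →L[ℂ] H)}
    {X : H →L[ℂ] H} (hX : conjAverage ν u X = X) {ξ : H}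
    (h : (vectorState ξ (conjAverage ν u (star X * X) - star X * X)).re ≤ 0) {g : ι}
    (hg : g ∈ ν.support) : conjCLM (u g) X ξ = X ξ := by
  have h1 : HasSum (fun g => (ν g).toReal * ‖(conjCLM (u g) X - X) ξ‖ ^ 2)
      (vectorState ξ (conjAverage ν u (star X * X) - star X * X)).re := by
    refine (Complex.reCLM.hasSum ((vectorState ξ).hasSum
      (hasSum_conjAverage_schwarz ν u hX))).congr_fun fun g => ?_
    rw [map_smul, smul_eq_mul, Complex.reCLM_apply, Complex.re_ofReal_mul,
      re_vectorState_star_mul_self]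
  have h2 := (le_hasSum h1 g fun j _ => by positivity).trans h
  have hpos := ENNReal.toReal_pos ((ν.mem_support_iff g).1 hg) (ν.apply_ne_top g)
  have h3 : ‖(conjCLM (u g) X - X) ξ‖ ^ 2 = 0 :=
    le_antisymm (nonpos_of_mul_nonpos_right h2 hpos) (sq_nonneg _)
  have h4 := norm_eq_zero.1 (pow_eq_zero_iff two_ne_zero |>.1 h3)
  exact sub_eq_zero.1 h4

end VectorState

/-! ### The regular representations and the center of the group von Neumann algebra. -/

section Regular

variable {Γ : Type*}

/-- The basis vector `δ_x` of `ℓ²(Γ)`. -/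
def delta (x : Γ) : L2 Γ := by
  classical exact lp.single 2 x (1 : ℂ)

theorem delta_apply_self (x : Γ) : (delta x : Γ → ℂ) x = 1 := by
  classical
  exact lp.single_apply_self (E := fun _ : Γ => ℂ) 2 x 1

theorem delta_apply_ne {x y : Γ} (h : y ≠ x) : (delta x : Γ → ℂ) y = 0 := by
  classical
  exact lp.single_apply_ne (E := fun _ : Γ => ℂ) 2 x 1 h

theorem inner_delta (x : Γ) (ξ : L2 Γ) : inner ℂ (delta x) ξ = (ξ : Γ → ℂ) x := by
  classical
  refine (lp.inner_single_left (𝕜 := ℂ) x (1 : ℂ) ξ).trans ?_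
  simp

theorem hasSum_smul_delta (ξ : L2 Γ) : HasSum (fun x => (ξ : Γ → ℂ) x • delta x) ξ := by
  classical
  refine (lp.hasSum_single ENNReal.ofNat_ne_top ξ).congr_fun fun x => ?_
  unfold delta
  rw [← lp.single_smul, smul_eq_mul, mul_one]

theorem hasSum_apply (S : BL2 Γ) (ξ : L2 Γ) :
    HasSum (fun x => (ξ : Γ → ℂ) x • S (delta x)) (S ξ) := by
  refine (S.hasSum (hasSum_smul_delta ξ)).congr_fun fun x => ?_
  rw [map_smul]

theorem hasSum_apply_apply (S : BL2 Γ) (ξ : L2 Γ) (z : Γ) :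
    HasSum (fun x => (ξ : Γ → ℂ) x * (S (delta x) : Γ → ℂ) z) ((S ξ : Γ → ℂ) z) := by
  have h := (innerSL ℂ (delta z)).hasSum (hasSum_apply S ξ)
  simp only [innerSL_apply_apply, inner_delta] at h
  exact h

theorem ext_delta {S T : BL2 Γ} (h : ∀ x, S (delta x) = T (delta x)) : S = T :=
  ContinuousLinearMap.ext fun ξ =>
    (hasSum_apply S ξ).unique ((hasSum_apply T ξ).congr_fun fun x => by rw [h])

/-- The unitary `ξ ↦ ξ ∘ σ`. -/
def permUnitary (σ : Equiv.Perm Γ) : unitary (BL2 Γ) :=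
  ⟨(permIsometry σ).toContinuousLinearMap, by
    have h1 : star (permIsometry σ).toContinuousLinearMap * (permIsometry σ).toContinuousLinearMap
        = 1 := by
      exact (ContinuousLinearMap.norm_map_iff_adjoint_comp_self _).1 (permIsometry σ).norm_map
    have h2 : (permIsometry σ).toContinuousLinearMap *
        (permIsometry σ.symm).toContinuousLinearMap = 1 := by
      ext ξ x
      exact congrArg (ξ : Γ → ℂ) (σ.symm_apply_apply x)
    refine ⟨h1, ?_⟩
    rw [left_inv_eq_right_inv h1 h2, h2]⟩

theorem permUnitary_apply (σ : Equiv.Perm Γ) (ξ : L2 Γ) (x : Γ) :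
    ((permUnitary σ : BL2 Γ) ξ : Γ → ℂ) x = (ξ : Γ → ℂ) (σ x) := rfl

theorem permUnitary_delta (σ : Equiv.Perm Γ) (x : Γ) :
    (permUnitary σ : BL2 Γ) (delta x) = delta (σ.symm x) := by
  ext y
  rw [permUnitary_apply]
  by_cases h : y = σ.symm x
  · subst h
    rw [Equiv.apply_symm_apply, delta_apply_self, delta_apply_self]
  · rw [delta_apply_ne h, delta_apply_ne fun h' => h ((Equiv.eq_symm_apply σ).2 h')]

theorem star_permUnitary_delta (σ : Equiv.Perm Γ) (x : Γ) :
    star (permUnitary σ : BL2 Γ) (delta x) = delta (σ x) := by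
  have h : delta x = (permUnitary σ : BL2 Γ) (delta (σ x)) := by
    rw [permUnitary_delta, Equiv.symm_apply_apply]
  rw [h]
  exact congrArg (fun f : BL2 Γ => f (delta (σ x))) (Unitary.coe_star_mul_self (permUnitary σ))

variable [Group Γ]

/-- The left regular representation, by unitaries. -/
def leftUnitary (g : Γ) : unitary (BL2 Γ) := permUnitary (Equiv.mulLeft g⁻¹)

/-- The right regular representation, by unitaries. -/
def rightUnitary (g : Γ) : unitary (BL2 Γ) := permUnitary (Equiv.mulRight g)

theorem coe_leftUnitary (g : Γ) : (leftUnitary g : BL2 Γ) = leftReg g := rfl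

theorem coe_rightUnitary (g : Γ) : (rightUnitary g : BL2 Γ) = rightReg g := rfl

theorem leftReg_apply (g : Γ) (ξ : L2 Γ) (x : Γ) :
    (leftReg g ξ : Γ → ℂ) x = (ξ : Γ → ℂ) (g⁻¹ * x) := rfl

theorem rightReg_apply (g : Γ) (ξ : L2 Γ) (x : Γ) :
    (rightReg g ξ : Γ → ℂ) x = (ξ : Γ → ℂ) (x * g) := rfl

theorem leftReg_delta (g x : Γ) : leftReg g (delta x) = delta (g * x) := by
  rw [← coe_leftUnitary, leftUnitary, permUnitary_delta]
  simp

theorem rightReg_delta (g x : Γ) : rightReg g (delta x) = delta (x * g⁻¹) := by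
  rw [← coe_rightUnitary, rightUnitary, permUnitary_delta]
  simp

theorem star_rightReg_delta (g x : Γ) : star (rightReg g) (delta x) = delta (x * g) :=
  star_permUnitary_delta _ x

theorem rightUnitary_one : rightUnitary (1 : Γ) = 1 := by
  refine Subtype.ext (ext_delta fun x => ?_)
  rw [coe_rightUnitary, rightReg_delta]
  simp

theorem commute_leftReg_rightReg (g h : Γ) : Commute (leftReg g) (rightReg h) :=
  ext_delta fun x => by
    change leftReg g (rightReg h (delta x)) = rightReg h (leftReg g (delta x))
    rw [leftReg_delta, rightReg_delta, rightReg_delta, leftReg_delta, mul_assoc]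

theorem commute_rightUnitary_star_leftUnitary (g h : Γ) :
    Commute (rightUnitary g) (star (leftUnitary h)) := by
  have h1 : Commute (leftUnitary h) (rightUnitary g) :=
    Subtype.ext (commute_leftReg_rightReg h g).eq
  have h2 := h1.inv_left
  rw [← Unitary.star_eq_inv] at h2
  exact h2.symm

theorem markov_eq (ν : PMF Γ) (T : BL2 Γ) : markov ν T = conjAverage ν rightUnitary T := by
  rw [conjAverage_apply]
  rfl

theorem markovOp_eq (ν : PMF Γ) (T : BL2 Γ) :
    markovOp ν T = conjAverage ν (fun g => star (leftUnitary g)) T := by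
  rw [conjAverage_apply]
  simp only [Unitary.coe_star, star_star]
  rfl

/-- An operator commuting with the right regular representation is determined by its value at the
identity. -/
theorem eq_of_commute_rightReg {S T : BL2 Γ} (hS : ∀ g, Commute (rightReg g) S)
    (hT : ∀ g, Commute (rightReg g) T) (h : S (delta 1) = T (delta 1)) : S = T :=
  ext_delta fun x => by
    have key : ∀ R : BL2 Γ, (∀ g, Commute (rightReg g) R) →
        R (delta x) = rightReg x⁻¹ (R (delta 1)) := by
      intro R hR
      have h1 : delta x = rightReg x⁻¹ (delta 1) := by rw [rightReg_delta]; simp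
      rw [h1]
      exact (congrArg (fun f : BL2 Γ => f (delta 1)) (hR x⁻¹).eq).symm
    rw [key S hS, key T hT, h]

/-- An operator commuting with the left regular representation is determined by its value at the
identity. -/
theorem eq_of_commute_leftReg {S T : BL2 Γ} (hS : ∀ g, Commute (leftReg g) S)
    (hT : ∀ g, Commute (leftReg g) T) (h : S (delta 1) = T (delta 1)) : S = T :=
  ext_delta fun x => by
    have key : ∀ R : BL2 Γ, (∀ g, Commute (leftReg g) R) →
        R (delta x) = leftReg x (R (delta 1)) := by
      intro R hR
      have h1 : delta x = leftReg x (delta 1) := by rw [leftReg_delta]; simp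
      rw [h1]
      exact (congrArg (fun f : BL2 Γ => f (delta 1)) (hR x).eq).symm
    rw [key S hS, key T hT, h]

/-- An operator commuting with both regular representations commutes with every operator commuting
with the left regular representation. -/
theorem commute_of_commute_leftReg_rightReg {S T : BL2 Γ} (hTl : ∀ g, Commute (leftReg g) T)
    (hTr : ∀ g, Commute (rightReg g) T) (hS : ∀ g, Commute (leftReg g) S) : Commute S T := by
  refine eq_of_commute_leftReg (fun g => (hS g).mul_right (hTl g))
    (fun g => (hTl g).mul_right (hS g)) ?_
  ext z
  have h1 := hasSum_apply_apply S (T (delta 1)) z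
  have h2 := hasSum_apply_apply T (S (delta 1)) z
  -- Both coefficients at z are convolution sums; the substitution g ↦ g⁻¹z matches them term by
  -- term.
  have h3 := (Equiv.hasSum_iff ((Equiv.inv Γ).trans (Equiv.mulRight z))).2 h2
  refine h1.unique (h3.congr_fun fun g => ?_)
  have hl : delta g = leftReg g (delta 1) := by rw [leftReg_delta, mul_one]
  have hr : ∀ x : Γ, delta x = rightReg x⁻¹ (delta 1) := fun x => by
    rw [rightReg_delta]; simp
  have e1 : S (delta g) = leftReg g (S (delta 1)) := by
    rw [hl]
    exact (congrArg (fun f : BL2 Γ => f (delta 1)) (hS g).eq).symm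
  have e2 : ∀ x : Γ, T (delta x) = rightReg x⁻¹ (T (delta 1)) := fun x => by
    rw [hr x]
    exact (congrArg (fun f : BL2 Γ => f (delta 1)) (hTr x⁻¹).eq).symm
  change _ = (S (delta 1) : Γ → ℂ) (g⁻¹ * z) * (T (delta (g⁻¹ * z)) : Γ → ℂ) z
  rw [e1, e2 (g⁻¹ * z), leftReg_apply, rightReg_apply, mul_comm]
  have h4 : z * (g⁻¹ * z)⁻¹ = g := by group
  rw [h4]

/-- Membership in L(Γ) means commuting with everything in the commutant of λ, which the preceding
convolution computation gives without the commutation theorem for L(Γ). -/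
theorem mem_center_groupVN {T : BL2 Γ} (hTl : ∀ g, Commute (leftReg g) T)
    (hTr : ∀ g, Commute (rightReg g) T) : T ∈ vonNeumannCenter (groupVN Γ) := by
  have hmem : ∀ A : BL2 Γ, A ∈ groupVN Γ ↔ A ∈ StarSubalgebra.centralizer ℂ
      (StarSubalgebra.centralizer ℂ (Set.range (leftReg : Γ → BL2 Γ)) : Set (BL2 Γ)) :=
    fun A => Iff.rfl
  have hstar : ∀ g : Γ, star (leftReg g) = leftReg g⁻¹ := fun g =>
    ext_delta fun x => (star_permUnitary_delta _ x).trans (leftReg_delta g⁻¹ x).symm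
  have hcomm : ∀ S : BL2 Γ, S ∈ StarSubalgebra.centralizer ℂ (Set.range (leftReg : Γ → BL2 Γ)) ↔
      ∀ g, Commute (leftReg g) S := by
    intro S
    rw [StarSubalgebra.mem_centralizer_iff]
    constructor
    · exact fun h g => (h _ ⟨g, rfl⟩).1
    · rintro h _ ⟨g, rfl⟩
      exact ⟨h g, by rw [hstar]; exact h g⁻¹⟩
  refine ⟨(hmem T).2 ?_, fun A hA => ?_⟩
  · rw [StarSubalgebra.mem_centralizer_iff]
    intro S hS
    exact ⟨commute_of_commute_leftReg_rightReg hTl hTr ((hcomm S).1 hS),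
      commute_of_commute_leftReg_rightReg hTl hTr ((hcomm (star S)).1 (star_mem hS))⟩
  · exact ((StarSubalgebra.mem_centralizer_iff ℂ).1 ((hmem A).1 hA) T ((hcomm T).2 hTl)).1

end Regular

/-! ### Bi-fixed operators are central. -/

section Center

variable {Γ : Type*} [Group Γ] {ν : PMF Γ} {T : BL2 Γ}

theorem commute_of_conjCLM_eq {A : Type*} [CStarAlgebra A] {u : unitary A} {X : A}
    (h : conjCLM u X = X) : Commute (u : A) X := by
  rw [conjCLM_apply] at h
  change (u : A) * X = X * u
  conv_rhs => rw [← h]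
  rw [mul_assoc, Unitary.coe_star_mul_self, mul_one]

/-- Both ρ_g* and λ_g send δ_e to δ_g, so the two averages of the state agree term by term. -/
theorem vectorState_delta_one_conjAverage (X : BL2 Γ) :
    vectorState (delta (1 : Γ)) (conjAverage ν rightUnitary X) =
      vectorState (delta (1 : Γ)) (conjAverage ν (fun g => star (leftUnitary g)) X) := by
  refine (hasSum_vectorState_conjAverage ν _ _ X).unique
    ((hasSum_vectorState_conjAverage ν _ _ X).congr_fun fun g => ?_)
  rw [Unitary.coe_star, star_star, coe_leftUnitary, coe_rightUnitary, leftReg_delta,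
    star_rightReg_delta, mul_one, one_mul]

omit [Group Γ] in
theorem re_vectorState_pow_nonneg (u : Γ → unitary (BL2 Γ)) (ξ : L2 Γ) (n : ℕ) {X : BL2 Γ}
    (hX : 0 ≤ X) : 0 ≤ (vectorState ξ ((conjAverage ν u ^ n) X)).re := by
  refine re_vectorState_nonneg ξ ?_
  induction n with
  | zero => exact hX
  | succ n ih => rw [pow_succ']; exact conjAverage_nonneg ν u ih

/-- At δ_y, the value of Uⁿ⁺¹W is the ν-average over k of the nonnegative values of UⁿW at δ_{ky}.
Each step to a neighbour uses up one power of U, which is why all powers are carried through the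
induction. -/
theorem re_vectorState_delta_nonpos (hν : IsSymmetric ν) (hgen : IsGenerating ν) {W : BL2 Γ}
    (hW : 0 ≤ W) (h : ∀ n : ℕ, (vectorState (delta (1 : Γ))
      ((conjAverage ν (fun g => star (leftUnitary g)) ^ n) W)).re ≤ 0) (w : Γ) :
    (vectorState (delta w) W).re ≤ 0 := by
  set U := conjAverage ν (fun g : Γ => star (leftUnitary g)) with hU
  have step : ∀ k ∈ ν.support, ∀ y : Γ, (∀ n : ℕ, (vectorState (delta y) ((U ^ n) W)).re ≤ 0) →
      ∀ n : ℕ, (vectorState (delta (k * y)) ((U ^ n) W)).re ≤ 0 := by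
    intro k hk y hy n
    have h1 := hasSum_re_vectorState_conjAverage ν (fun g : Γ => star (leftUnitary g)) (delta y)
      ((U ^ n) W)
    have h2 := le_hasSum h1 k fun j _ =>
      mul_nonneg ENNReal.toReal_nonneg (re_vectorState_pow_nonneg _ _ n hW)
    have h3 := hy (n + 1)
    rw [pow_succ'] at h3
    have h4 := h2.trans h3
    rw [Unitary.coe_star, star_star, coe_leftUnitary, leftReg_delta] at h4
    exact nonpos_of_mul_nonpos_right h4
      (ENNReal.toReal_pos ((ν.mem_support_iff k).1 hk) (ν.apply_ne_top k))
  have hw : w ∈ Subgroup.closure ν.support := by rw [hgen]; trivial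
  have hall : ∀ n : ℕ, (vectorState (delta w) ((U ^ n) W)).re ≤ 0 := by
    induction hw using Subgroup.closure_induction_left with
    | one => exact h
    | mul_left k hk y _ ih => exact step k hk y ih
    | inv_mul_cancel k hk y _ ih =>
      -- Symmetry of ν puts k⁻¹ in the support, so positive words already reach the whole group.
      refine step k⁻¹ ?_ y ih
      rw [PMF.mem_support_iff] at hk ⊢
      rwa [hν k]
  exact hall 0

theorem commute_of_forall_support {M : Type*} [Monoid M] {ρ : Γ → M}
    (hgen : IsGenerating ν) (hone : ρ 1 = 1) (hmul : ∀ g h, ρ (g * h) = ρ g * ρ h) {X : M}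
    (h : ∀ g ∈ ν.support, Commute (ρ g) X) (g : Γ) : Commute (ρ g) X := by
  have hg : g ∈ Subgroup.closure ν.support := by rw [hgen]; trivial
  induction hg using Subgroup.closure_induction with
  | mem x hx => exact h x hx
  | one => rw [hone]; exact Commute.one_left X
  | mul x y _ _ hx hy => rw [hmul]; exact hx.mul_left hy
  | inv x _ hx =>
    have h1 : ρ x⁻¹ * ρ x = 1 := by rw [← hmul, inv_mul_cancel, hone]
    have h2 : ρ x * ρ x⁻¹ = 1 := by rw [← hmul, mul_inv_cancel, hone]
    exact Commute.units_inv_left (u := ⟨ρ x, ρ x⁻¹, h2, h1⟩) hx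

theorem rightReg_mul (g h : Γ) : (rightReg (g * h) : BL2 Γ) = rightReg g * rightReg h :=
  ext_delta fun x => by
    change _ = rightReg g (rightReg h (delta x))
    simp [rightReg_delta, mul_assoc]

theorem leftReg_mul (g h : Γ) : (leftReg (g * h) : BL2 Γ) = leftReg g * leftReg h :=
  ext_delta fun x => by
    change _ = leftReg g (leftReg h (delta x))
    simp [leftReg_delta, mul_assoc]

theorem leftReg_one : (leftReg 1 : BL2 Γ) = 1 :=
  ext_delta fun x => by rw [leftReg_delta, one_mul]; rfl

theorem commute_conjAverages (ν : PMF Γ) :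
    Commute (conjAverage ν rightUnitary) (conjAverage ν fun g : Γ => star (leftUnitary g)) :=
  commute_conjAverage_of_forall fun h => (commute_conjAverage_of_forall fun g =>
    (commute_conjCLM (commute_rightUnitary_star_leftUnitary g h)).symm).symm

theorem commute_rightReg_of_fixed (hν : IsSymmetric ν) (hgen : IsGenerating ν)
    (hP : conjAverage ν rightUnitary T = T)
    (hU : conjAverage ν (fun g => star (leftUnitary g)) T = T) (g : Γ) :
    Commute (rightReg g) T := by
  have hpos := star_mul_self_le_conjAverage ν _ hP
  have hsub := defect_le_conjAverage ν rightUnitary ν (fun g => star (leftUnitary g))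
    commute_rightUnitary_star_leftUnitary hP hU
  have hzero := re_pow_apply_coboundary_nonpos (commute_conjAverages ν)
    (φ := vectorState (delta (1 : Γ)))
    vectorState_delta_one_conjAverage (norm_conjAverage_apply_le ν _)
    (fun n X hX => re_vectorState_pow_nonneg _ _ n hX) hpos hsub
  have hall := re_vectorState_delta_nonpos hν hgen (sub_nonneg.2 hpos) hzero
  refine commute_of_forall_support hgen (congrArg Subtype.val rightUnitary_one) rightReg_mul
    (fun k hk => commute_of_conjCLM_eq (u := rightUnitary k) ?_) g
  exact ext_delta fun w => conjCLM_apply_eq_of_defect hP (hall w) hk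

/-- Since P fixes T*T and agrees with U under the state at δ_e, the U-defect of T*T vanishes there.
Thus λ_k* T λ_k and T agree at δ_e for k in the support, and commutation with ρ spreads this to
every δ_x. -/
theorem commute_leftReg_of_fixed (hgen : IsGenerating ν) (hT : ∀ g, Commute (rightReg g) T)
    (hU : conjAverage ν (fun g => star (leftUnitary g)) T = T) (g : Γ) :
    Commute (leftReg g) T := by
  have hTT : ∀ g, Commute (rightReg g) (star T * T) := by
    intro g
    have hs : star (rightReg g) = rightReg g⁻¹ := ext_delta fun x => by
      rw [star_rightReg_delta, rightReg_delta, inv_inv]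
    have h1 := (hT g⁻¹).star_star
    rw [← hs, star_star] at h1
    exact h1.mul_right (hT g)
  have hPTT : conjAverage ν rightUnitary (star T * T) = star T * T := by
    have h1 := hasSum_conjAverage_apply ν rightUnitary (star T * T)
    have h2 := (Complex.ofRealCLM.hasSum (PMF.hasSum_toReal ν)).smul_const (star T * T)
    refine h1.unique ?_
    have h3 : Complex.ofRealCLM 1 • (star T * T) = star T * T := by simp
    rw [h3] at h2
    refine h2.congr_fun fun k => ?_
    rw [conjCLM_apply, coe_rightUnitary, (hTT k).eq, mul_assoc, ← coe_rightUnitary,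
      ← Unitary.coe_star, Unitary.coe_mul_star_self, mul_one]
    rfl
  have hdef : (vectorState (delta (1 : Γ)) (conjAverage ν (fun g => star (leftUnitary g))
      (star T * T) - star T * T)).re ≤ 0 := by
    rw [map_sub, ← vectorState_delta_one_conjAverage, hPTT, sub_self]
    rfl
  refine commute_of_forall_support hgen leftReg_one leftReg_mul (fun k hk => ?_) g
  have h1 := conjCLM_apply_eq_of_defect hU hdef hk
  have h2 : conjCLM (star (leftUnitary k)) T = T := by
    refine eq_of_commute_rightReg (fun h => ?_) hT h1
    have h3 : Commute (rightReg h) (leftReg k) := (commute_leftReg_rightReg k h).symm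
    have h4 : Commute (rightReg h) (star (leftUnitary k : BL2 Γ)) :=
      congrArg Subtype.val (commute_rightUnitary_star_leftUnitary h k).eq
    rw [conjCLM_apply, Unitary.coe_star, star_star, coe_leftUnitary]
    exact (h4.mul_right (hT h)).mul_right h3
  have h5 := commute_of_conjCLM_eq h2
  have h7 : (leftUnitary k : BL2 Γ) * star (leftUnitary k : BL2 Γ) = 1 :=
    Unitary.coe_mul_star_self _
  have h8 : star (leftUnitary k : BL2 Γ) * (leftUnitary k : BL2 Γ) = 1 :=
    Unitary.coe_star_mul_self _
  exact Commute.units_inv_left (u := ⟨_, _, h8, h7⟩) h5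

end Center

end Biharmonic
end

theorem mainTheorem5 {Γ : Type*} [Group Γ] [Countable Γ] (ν : PMF Γ)
    (he : (1 : Γ) ∈ ν.support) (T : Biharmonic.BL2 Γ)
    (hT : (Biharmonic.markov ν ∘ Biharmonic.markovOp ν) T = T) :
    T ∈ Biharmonic.Har (Biharmonic.markov ν) ∩ Biharmonic.Har (Biharmonic.markovOp ν) ∧
      (Biharmonic.IsSymmetric ν → Biharmonic.IsGenerating ν →
        T ∈ Biharmonic.vonNeumannCenter (Biharmonic.groupVN Γ)) := by
  rw [Function.comp_apply, Biharmonic.markovOp_eq, Biharmonic.markov_eq] at hT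
  have ha := ENNReal.toReal_pos ((ν.mem_support_iff 1).1 he) (ν.apply_ne_top 1)
  obtain ⟨hP, hU⟩ := Biharmonic.fixed_of_comp_fixed (Biharmonic.commute_conjAverages ν) ha
    (Biharmonic.norm_conjAverage_apply_le ν _) (Biharmonic.norm_conjAverage_apply_le ν _)
    (Biharmonic.norm_conjAverage_sub_le ν _ Biharmonic.rightUnitary_one) hT
  refine ⟨⟨(Biharmonic.markov_eq ν T).trans hP, (Biharmonic.markovOp_eq ν T).trans hU⟩,
    fun hν hgen => ?_⟩
  have hr := Biharmonic.commute_rightReg_of_fixed hν hgen hP hU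
  exact Biharmonic.mem_center_groupVN (Biharmonic.commute_leftReg_of_fixed hgen hr hU) hr
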